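/- **Definitions.** A *partial $(2,1)$-algebra* is a set $S$ with a partially defined binary operation and a map $s\mapsto s^+$; put $S^+=\{s^+: s\in S\}$. *Left restriction semigroups.* A partial $(2,1)$-algebra $S$ is a *semigroupoid* if, whenever ($st$ and $tr$ are defined) or ($st$ and $(st)r$ are defined) or ($tr$ and $s(tr)$ are defined), all of $st,\ tr,\ (st)r,\ s(tr)$ are defined and $(st)r=s(tr)$. It is a *left restriction semigroupoid* if moreover: $s^+s$ is defined and equals $s$; $s^+t^+$ is defined iff $t^+s^+$ is, and then they are equal; if $s^+t$ is defined then $(s^+t)^+=s^+t^+$; if $st$ is defined then $st^+=(st)^+s$. It is a *left restriction semigroup* if in addition every product is defined. Its natural order is: $s\le t$ iff $s^+t$ is defined and equals $s$. A map $\varphi:S\to S'$ of left restriction semigroups is a *restriction morphism* if $\varphi(st)=\varphi(s)\varphi(t)$ whenever $st$ is defined and $\varphi(s^+)=\varphi(s)^+$; it is a *premorphism* if, whenever $st$ is defined, $\varphi(s)\varphi(t)$ and $\varphi(s)^+\varphi(st)$ are defined and equal, and $\varphi(s)^+\le\varphi(s^+)$ for all $s$. *Constellations.* A *left constellation* is a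 partial $(2,1)$-algebra $T$ such that: $xy,\ yz$ are defined iff $yz,\ x(yz)$ are defined, and in that case $(xy)z$ is defined and $x(yz)=(xy)z$; for $e\in T^+$, ($ex$ is defined and $ex=x$) iff $e=x^+$; if $e\in T^+$ and $xe$ is defined then $xe=x$. Let $\le$ be a partial order on $T$. For $x\in T$, $e\in T^+$, the *corestriction* $x|e$ is the maximum element of $\{y : y\le x,\ ye \text{ defined}\}$; we say it exists, $x|e\ne\emptyset$, when this maximum exists. When $x|y^+\neq\emptyset$ and $(x|y^+)y$ is defined, put $x\otimes y=(x|y^+)y$. The pair $(T,\le)$ is *locally inductive* (an *li-constellation*) if for $x,x',y,y'\in T$ and $e,f\in T^+$: 1. if $x\le y$, $x'\le y'$ and $xx',yy'$ are defined, then $xx'\le yy'$; 2. if $x\le y$ then $x^+\le y^+$; 3. if $e\le x^+$ there is a unique $r$ (the *restriction* of $x$ to $e$) with $r\le x$ and $r^+=e$; 4. if $\{y : y\le x,\ ye\text{ defined}\}$ is non-empty, then $x|e\neq\emptyset$; 5. if $xy$ is defined, then $(xy)|e\ne\emptyset$ iff $y|e\neq\emptyset$; 6. if $f\le e$, then $x|e\ne\emptyset$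 iff $x|f\ne\emptyset$; 7. if $xy$ is defined and $(xy)|e\neq\emptyset$, then $((xy)|e)^+=(x|(y|e)^+)^+$; 8. if $e\le f$, the restriction of $f$ to $e$ coincides with the corestriction $e|f$; 9. every connected component of $(T^+,\le)$ (for the equivalence relation generated by $\le$) is a meet-semilattice, and its meet is given by corestriction: $e|f$ exists exactly when $e,f$ lie in the same component, and then $e|f=e\wedge f$. It is *non-degenerate* if every $x\in T$ has some $e\in T^+$ with $x|e\neq\emptyset$. It is an *inductive left constellation* (Gould–Hollings) if 1, 2, 3, 7, 8 hold, $x|e$ exists for all $x\in T$, $e\in T^+$, and $(T^+,\le)$ is a meet-semilattice with meet $e|f$. An *inductive radiant* is a map $\varphi:T\to L$ such that, for $x,y\in T$, $e\in T^+$: if $xy$ is defined then $\varphi(x)\varphi(y)$ is defined and equals $\varphi(xy)$; $\varphi(x)^+=\varphi(x^+)$; $x\le y$ implies $\varphi(x)\le\varphi(y)$; if $x|e\neq\emptyset$ then $\varphi(x)|\varphi(e)\neq\emptyset$ and $\varphi(x|e)=\varphi(x)|\varphi(e)$. An *inductive preradiant* is a map $\varphi:T\to L$ such that: if $xy$ is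 defined then $\varphi(x)\otimes\varphi(y)$ and $\varphi(x)^+\otimes\varphi(xy)$ are defined and equal; $\varphi(x)^+\le\varphi(x^+)$; $x\le y$ implies $\varphi(x)\le\varphi(y)$; if $x|e\neq\emptyset$ then $\varphi(x)|\varphi(e)\neq\emptyset$ and $\varphi(x|e)=\varphi(x)|\varphi(e)$; if $e\le x^+$ and $r$ is the restriction of $x$ to $e$, then $\varphi(r)^+$ is the corestriction $\varphi(e)|\varphi(x)^+$. For a left restriction semigroup $S$ let $C(S)$ be the set $S$ with the same $^+$, the natural order, and the partial product $s\bullet t=st$, defined iff $st^+$ is defined and equals $s$. For a non-degenerate li-constellation $T$ whose projections $(T^+,\le)$ form a meet-semilattice let $G(T)$ be the set $T$ with the same $^+$ and the product $\otimes$. **Theorem (ESN-type theorem for left restriction semigroups).** In (i), (ii), (v), (vi) the classes of objects and maps named form categories under composition of functions, and $C$ and $G$, acting identically on underlying functions, are mutually inverse isomorphisms between them. (i) The category of left restriction semigroups and restriction morphisms is isomorphic to the category of non-degenerate li-constellations $(T,\le)$ such that $(T^+,\le)$ is a meet-semilattice, with inductive radiants. (ii) The category of left restriction semigroups and premorphisms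 is isomorphic to the category of non-degenerate li-constellations $(T,\le)$ such that $(T^+,\le)$ is a meet-semilattice, with inductive preradiants. Moreover this recovers the one-sided theorem of Gould and Hollings: (iii) the non-degenerate li-constellations $(T,\le)$ such that $(T^+,\le)$ is a meet-semilattice are exactly the inductive left constellations; (iv) the restriction morphisms between left restriction semigroups are exactly the $(2,1)$-morphisms, i.e. the maps preserving the product and $^+$; (v) the category of left restriction semigroups and $(2,1)$-morphisms is isomorphic to the category of inductive left constellations and ordered radiants (maps satisfying the conditions of an inductive radiant, corestrictions being always defined); (vi) the category of left restriction semigroups and strong premorphisms (maps with $\varphi(s)\varphi(t)=\varphi(s)^+\varphi(st)$ and $\varphi(s)^+\le\varphi(s^+)$) is isomorphic to the category of inductive left constellations and ordered preradiants (maps satisfying the conditions of an inductive preradiant, corestrictions being always defined). -/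

import Mathlib

open CategoryTheory

universe u

namespace ESN

/-! ### Partial algebras of type (2,1) -/

/-- A set `S` with a partially defined binary operation and a unary operation `+`.
The pair `(s, t)` lies in `S⁽²⁾` when `(S.mul s t).Dom`; the statement "`st` is defined and `st = p`"
is `p ∈ S.mul s t`. -/
structure PartialAlgebra where
  carrier : Type u
  mul : carrier → carrier → Part carrier
  plus : carrier → carrier

namespace PartialAlgebra

variable (S : PartialAlgebra.{u})

/-- `S⁺ = { s⁺ : s ∈ S }`. -/
def IsProj (e : S.carrier) : Prop := ∃ s, S.plus s = e

/-- The associativity law of a semigroupoid. -/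
def IsSemigroupoid : Prop :=
  ∀ s t r : S.carrier,
    (((S.mul s t).Dom ∧ (S.mul t r).Dom) ∨
      (∃ p ∈ S.mul s t, (S.mul p r).Dom) ∨
      (∃ q ∈ S.mul t r, (S.mul s q).Dom)) →
    ∃ p ∈ S.mul s t, ∃ q ∈ S.mul t r, ∃ w, w ∈ S.mul p r ∧ w ∈ S.mul s q

/-- Left restriction semigroupoids. -/
structure IsLeftRestrictionSemigroupoid : Prop where
  semigroupoid : S.IsSemigroupoid
  /-- `s⁺s` is defined and equals `s`. -/
  plus_mul : ∀ s, s ∈ S.mul (S.plus s) s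
  /-- `s⁺t⁺` is defined iff `t⁺s⁺` is, and then they agree. -/
  plus_comm : ∀ s t, S.mul (S.plus s) (S.plus t) = S.mul (S.plus t) (S.plus s)
  /-- If `s⁺t` is defined, then `(s⁺t)⁺ = s⁺t⁺`. -/
  plus_plus_mul : ∀ s t, ∀ p ∈ S.mul (S.plus s) t, S.plus p ∈ S.mul (S.plus s) (S.plus t)
  /-- If `st` is defined, then `st⁺ = (st)⁺s`. -/
  mul_plus : ∀ s t, ∀ p ∈ S.mul s t, ∃ w, w ∈ S.mul s (S.plus t) ∧ w ∈ S.mul (S.plus p) s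

/-- A left restriction semigroup is a left restriction semigroupoid with `S⁽²⁾ = S × S`. -/
structure IsLeftRestrictionSemigroup : Prop extends S.IsLeftRestrictionSemigroupoid where
  total : ∀ s t, (S.mul s t).Dom

/-- The natural partial order: `s ≤ t` iff `s⁺t` is defined and `s⁺t = s`. -/
def natLE (s t : S.carrier) : Prop := s ∈ S.mul (S.plus s) t

/-- Left constellations. -/
structure IsLeftConstellation : Prop where
  /-- `xy`, `yz` are defined iff `yz`, `x(yz)` are defined. -/
  dom_iff : ∀ x y z,
    ((S.mul x y).Dom ∧ (S.mul y z).Dom) ↔ ∃ q ∈ S.mul y z, (S.mul x q).Dom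
  /-- If `xy`, `yz` are defined, then `(xy)z` is defined and `x(yz) = (xy)z`. -/
  assoc : ∀ x y z, ∀ p ∈ S.mul x y, ∀ q ∈ S.mul y z, ∃ w, w ∈ S.mul x q ∧ w ∈ S.mul p z
  /-- For `e ∈ S⁺`: `ex` is defined with `ex = x` iff `e = x⁺`. -/
  proj_mul : ∀ e x, S.IsProj e → (x ∈ S.mul e x ↔ e = S.plus x)
  /-- For `e ∈ S⁺`: if `xe` is defined, then `xe = x`. -/
  mul_proj : ∀ x e, S.IsProj e → (S.mul x e).Dom → x ∈ S.mul x e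

end PartialAlgebra

/-! ### Morphisms of left restriction semigroupoids -/

section SemigroupMorphisms

variable (S T : PartialAlgebra.{u}) (f : S.carrier → T.carrier)

/-- Restriction morphisms. -/
structure IsRestrictionMorphism : Prop where
  map_mul : ∀ s t, ∀ p ∈ S.mul s t, f p ∈ T.mul (f s) (f t)
  map_plus : ∀ s, f (S.plus s) = T.plus (f s)

/-- Premorphisms. -/
structure IsPremorphism : Prop where
  /-- If `st` is defined, then `f(s)f(t)` and `f(s)⁺f(st)` are defined and equal. -/
  map_mul : ∀ s t, ∀ p ∈ S.mul s t,
    ∃ w, w ∈ T.mul (f s) (f t) ∧ w ∈ T.mul (T.plus (f s)) (f p)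
  plus_le : ∀ s, T.natLE (T.plus (f s)) (f (S.plus s))

/-- (2,1)-morphisms: maps preserving both operations. -/
structure IsTwoOneMorphism : Prop where
  map_mul : ∀ s t, (S.mul s t).map f = T.mul (f s) (f t)
  map_plus : ∀ s, f (S.plus s) = T.plus (f s)

/-- Strong premorphisms of left restriction semigroups: `f(s)f(t) = f(s)⁺f(st)` and
`f(s)⁺ ≤ f(s⁺)`. -/
structure IsStrongPremorphism : Prop where
  map_mul : ∀ s t,
    T.mul (f s) (f t) = (S.mul s t).bind fun p => T.mul (T.plus (f s)) (f p)
  plus_le : ∀ s, T.natLE (T.plus (f s)) (f (S.plus s))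

end SemigroupMorphisms

/-! ### Order-theoretic notions -/

section Order

variable {X : Type u} (le : X → X → Prop)

/-- `z` is the meet of `x` and `y`. -/
def IsMeet (x y z : X) : Prop := le z x ∧ le z y ∧ ∀ z', le z' x → le z' y → le z' z

/-- Every two elements have a meet. -/
def IsMeetSemilattice : Prop := ∀ x y, ∃ z, IsMeet le x y z

/-- `x` and `y` lie in the same connected component: they are joined by a finite zigzag of
comparable elements. -/
def Connected (x y : X) : Prop := Relation.EqvGen le x y

/-- Every connected component is a meet-semilattice (all lower bounds of an element lie in its
component, so meets may be computed in the whole set). -/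
def IsLocalMeetSemilattice : Prop := ∀ x y, Connected le x y → ∃ z, IsMeet le x y z

end Order

/-! ### Ordered partial algebras, restriction and corestriction -/

/-- A partial algebra of type (2,1) with a binary relation `≤`. -/
structure OrderedPartialAlgebra extends PartialAlgebra.{u} where
  le : carrier → carrier → Prop

namespace OrderedPartialAlgebra

variable (T : OrderedPartialAlgebra.{u})

/-- The set `T⁺` as a type. -/
def Proj : Type u := {e : T.carrier // T.IsProj e}

/-- The order of `T` on `T⁺`. -/
def projLE (e f : T.Proj) : Prop := T.le e.1 f.1

/-- `r ≤ x` and `r⁺ = e`: the element `r` is a restriction of `x` to `e`. -/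
def IsRestriction (e x r : T.carrier) : Prop := T.le r x ∧ T.plus r = e

/-- `c` is the maximum element of `{y : y ≤ x and ye is defined}`. -/
def IsCorestriction (x e c : T.carrier) : Prop :=
  (T.le c x ∧ (T.mul c e).Dom) ∧ ∀ y, T.le y x → (T.mul y e).Dom → T.le y c

/-- The corestriction `x|e`, defined when the above set has a maximum element (which is unique
when `≤` is a partial order); `x|e ≠ ∅` is `(T.corestr x e).Dom`. -/
noncomputable def corestr (x e : T.carrier) : Part T.carrier :=
  ⟨∃ c, T.IsCorestriction x e c, fun h => h.choose⟩

/-- The pseudo-product `x ⊗ y = (x|y⁺)y`. -/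
noncomputable def pseudo (x y : T.carrier) : Part T.carrier :=
  (T.corestr x (T.plus y)).bind fun c => T.mul c y

/-- Left constellations with a partial order satisfying the order axioms that are common to
locally inductive and inductive left constellations. -/
structure IsPreOrderedConstellation : Prop where
  constellation : T.IsLeftConstellation
  le_refl : ∀ x, T.le x x
  le_trans : ∀ x y z, T.le x y → T.le y z → T.le x z
  le_antisymm : ∀ x y, T.le x y → T.le y x → x = y
  mul_le_mul : ∀ x x' y y', T.le x y → T.le x' y' →
    ∀ p ∈ T.mul x x', ∀ q ∈ T.mul y y', T.le p q
  plus_le_plus : ∀ x y, T.le x y → T.le (T.plus x) (T.plus y)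
  restriction : ∀ e x, T.IsProj e → T.le e (T.plus x) → ∃! r, T.IsRestriction e x r

/-- Locally inductive left constellations (li-constellations). -/
structure IsLocallyInductive : Prop extends T.IsPreOrderedConstellation where
  /-- The set `{y : y ≤ x and ye is defined}` is empty or has a maximum element. -/
  corestriction : ∀ x e, T.IsProj e →
    (∃ y, T.le y x ∧ (T.mul y e).Dom) → (T.corestr x e).Dom
  /-- If `xy` is defined, then `(xy)|e ≠ ∅` iff `y|e ≠ ∅`. -/
  corestr_mul_dom : ∀ x y e, T.IsProj e → ∀ p ∈ T.mul x y,
    ((T.corestr p e).Dom ↔ (T.corestr y e).Dom)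
  /-- If `f ≤ e`, then `x|e ≠ ∅` iff `x|f ≠ ∅`. -/
  corestr_dom_iff : ∀ x e f, T.IsProj e → T.IsProj f → T.le f e →
    ((T.corestr x e).Dom ↔ (T.corestr x f).Dom)
  /-- If `xy` is defined and `(xy)|e ≠ ∅`, then `((xy)|e)⁺ = (x|(y|e)⁺)⁺`. -/
  plus_corestr_mul : ∀ x y e, T.IsProj e → ∀ p ∈ T.mul x y, ∀ c ∈ T.corestr p e,
    ∃ d ∈ T.corestr y e, ∃ b ∈ T.corestr x (T.plus d), T.plus c = T.plus b
  /-- If `e ≤ f`, the restriction `e|f` and the corestriction `e|f` coincide. -/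
  restr_eq_corestr : ∀ e f, T.IsProj e → T.IsProj f → T.le e f →
    ∃ r, T.IsRestriction e f r ∧ r ∈ T.corestr e f
  /-- `(T⁺, ≤)` is a local meet-semilattice. -/
  local_meet : IsLocalMeetSemilattice T.projLE
  /-- Its (partial) meet operation, defined on pairs of elements of the same connected component,
  is the corestriction. -/
  corestr_eq_meet : ∀ (e f : T.Proj) (c : T.carrier), c ∈ T.corestr e.1 f.1 ↔
    Connected T.projLE e f ∧ ∃ m : T.Proj, m.1 = c ∧ IsMeet T.projLE e f m

/-- For every `x` there is `e ∈ T⁺` with `x|e ≠ ∅`. -/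
def IsNonDegenerate : Prop := ∀ x, ∃ e, T.IsProj e ∧ (T.corestr x e).Dom

/-- Non-degenerate li-constellations whose projections form a meet-semilattice. -/
structure IsNonDegenerateSemilatticeLI : Prop where
  locallyInductive : T.IsLocallyInductive
  nonDegenerate : T.IsNonDegenerate
  semilattice : IsMeetSemilattice T.projLE

/-- Inductive left constellations in the sense of Gould and Hollings. -/
structure IsInductive : Prop extends T.IsPreOrderedConstellation where
  /-- All corestrictions exist. -/
  corestriction : ∀ x e, T.IsProj e → (T.corestr x e).Dom
  /-- If `xy` is defined, then `((xy)|e)⁺ = (x|(y|e)⁺)⁺`. -/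
  plus_corestr_mul : ∀ x y e, T.IsProj e → ∀ p ∈ T.mul x y, ∀ c ∈ T.corestr p e,
    ∃ d ∈ T.corestr y e, ∃ b ∈ T.corestr x (T.plus d), T.plus c = T.plus b
  /-- If `e ≤ f`, the restriction `e|f` and the corestriction `e|f` coincide. -/
  restr_eq_corestr : ∀ e f, T.IsProj e → T.IsProj f → T.le e f →
    ∃ r, T.IsRestriction e f r ∧ r ∈ T.corestr e f
  /-- `(T⁺, ≤)` is a meet-semilattice with meet given by corestriction. -/
  meet : ∀ e f : T.Proj, ∃ m : T.Proj, IsMeet T.projLE e f m ∧ m.1 ∈ T.corestr e.1 f.1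

end OrderedPartialAlgebra

/-! ### Radiants and preradiants -/

section Radiants

variable (T L : OrderedPartialAlgebra.{u}) (f : T.carrier → L.carrier)

/-- Inductive radiants. -/
structure IsInductiveRadiant : Prop where
  map_mul : ∀ x y, ∀ p ∈ T.mul x y, f p ∈ L.mul (f x) (f y)
  map_plus : ∀ x, L.plus (f x) = f (T.plus x)
  map_le : ∀ x y, T.le x y → L.le (f x) (f y)
  /-- If `x|e ≠ ∅`, then `f(x)|f(e) ≠ ∅` and `f(x|e) = f(x)|f(e)`. -/
  map_corestr : ∀ x e, T.IsProj e → ∀ c ∈ T.corestr x e, f c ∈ L.corestr (f x) (f e)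

/-- Inductive preradiants. -/
structure IsInductivePreradiant : Prop where
  /-- If `xy` is defined, then `f(x)|f(y)⁺` and `f(x)⁺|f(xy)⁺` exist and
  `f(x) ⊗ f(y) = f(x)⁺ ⊗ f(xy)`. -/
  map_mul : ∀ x y, ∀ p ∈ T.mul x y,
    ∃ w, w ∈ L.pseudo (f x) (f y) ∧ w ∈ L.pseudo (L.plus (f x)) (f p)
  plus_le : ∀ x, L.le (L.plus (f x)) (f (T.plus x))
  map_le : ∀ x y, T.le x y → L.le (f x) (f y)
  /-- If `x|e ≠ ∅`, then `f(x)|f(e) ≠ ∅` and `f(x|e) = f(x)|f(e)`. -/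
  map_corestr : ∀ x e, T.IsProj e → ∀ c ∈ T.corestr x e, f c ∈ L.corestr (f x) (f e)
  /-- If `e ≤ x⁺` and `r = e|x` (restriction), then `f(r)⁺ = f(e)|f(x)⁺` (corestriction). -/
  plus_map_restr : ∀ x e, T.IsProj e → T.le e (T.plus x) → ∀ r, T.IsRestriction e x r →
    L.plus (f r) ∈ L.corestr (f e) (L.plus (f x))

/-- Ordered radiants (between inductive left constellations, where corestriction is total). -/
structure IsOrderedRadiant : Prop where
  map_mul : ∀ x y, ∀ p ∈ T.mul x y, f p ∈ L.mul (f x) (f y)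
  map_plus : ∀ x, L.plus (f x) = f (T.plus x)
  map_le : ∀ x y, T.le x y → L.le (f x) (f y)
  map_corestr : ∀ x e, T.IsProj e → (T.corestr x e).map f = L.corestr (f x) (f e)

/-- Ordered preradiants (between inductive left constellations, where corestriction is total). -/
structure IsOrderedPreradiant : Prop where
  map_mul : ∀ x y, ∀ p ∈ T.mul x y, L.pseudo (f x) (f y) = L.pseudo (L.plus (f x)) (f p)
  plus_le : ∀ x, L.le (L.plus (f x)) (f (T.plus x))
  map_le : ∀ x y, T.le x y → L.le (f x) (f y)
  map_corestr : ∀ x e, T.IsProj e → (T.corestr x e).map f = L.corestr (f x) (f e)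
  plus_map_restr : ∀ x e, T.IsProj e → T.le e (T.plus x) → ∀ r, T.IsRestriction e x r →
    L.corestr (f e) (L.plus (f x)) = Part.some (L.plus (f r))

end Radiants

/-! ### The two constructions -/

/-- The ordered partial algebra `C(S)`: same elements and same `+`; `s • t` is defined, with value
`st`, when `st⁺` is defined and equals `s`; the order is the natural partial order. -/
abbrev PartialAlgebra.toConstellation (S : PartialAlgebra.{u}) : OrderedPartialAlgebra.{u} where
  carrier := S.carrier
  mul s t := Part.assert (s ∈ S.mul s (S.plus t)) fun _ => S.mul s t
  plus := S.plus
  le := S.natLE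

/-- The partial algebra `G(T)`: same elements and same `+`, with the pseudo-product. -/
noncomputable abbrev OrderedPartialAlgebra.toSemigroup (T : OrderedPartialAlgebra.{u}) :
    PartialAlgebra.{u} where
  carrier := T.carrier
  mul := T.pseudo
  plus := T.plus

/-! ### Categories of structured sets and functions -/

/-- The structures `A : D` with `ob A`, and the functions `f` between their underlying sets with
`hom A B f`, form a category under the usual composition of functions. -/
structure FormsCategory {D : Type (u + 1)} (carrier : D → Type u) (ob : D → Prop)
    (hom : ∀ A B : D, (carrier A → carrier B) → Prop) : Prop where
  id : ∀ A, ob A → hom A A id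
  comp : ∀ A B C, ob A → ob B → ob C → ∀ f g, hom A B f → hom B C g → hom A C (g ∘ f)

/-- The objects of the category given by `h : FormsCategory carrier ob hom`. -/
structure FunctionCat {D : Type (u + 1)} {carrier : D → Type u} {ob : D → Prop}
    {hom : ∀ A B : D, (carrier A → carrier B) → Prop} (h : FormsCategory carrier ob hom) where
  obj : D
  property : ob obj

instance {D : Type (u + 1)} {carrier : D → Type u} {ob : D → Prop}
    {hom : ∀ A B : D, (carrier A → carrier B) → Prop} (h : FormsCategory carrier ob hom) :
    Category.{u} (FunctionCat h) where
  Hom A B := {f : carrier A.obj → carrier B.obj // hom A.obj B.obj f}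
  id A := ⟨id, h.id A.obj A.property⟩
  comp {A B C} f g := ⟨g.1 ∘ f.1,
    h.comp A.obj B.obj C.obj A.property B.property C.property f.1 g.1 f.2 g.2⟩

/-- The given classes of partial algebras and functions, and of ordered partial algebras and
functions, form categories, and `S ↦ C(S)`, `T ↦ G(T)`, both being the identity on functions,
are mutually inverse isomorphisms between these categories. -/
def IsomorphicViaCG
    (ob₁ : PartialAlgebra.{u} → Prop)
    (hom₁ : ∀ S S' : PartialAlgebra.{u}, (S.carrier → S'.carrier) → Prop)
    (ob₂ : OrderedPartialAlgebra.{u} → Prop)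
    (hom₂ : ∀ T T' : OrderedPartialAlgebra.{u}, (T.carrier → T'.carrier) → Prop) : Prop :=
  ∃ (h₁ : FormsCategory (fun S : PartialAlgebra.{u} => S.carrier) ob₁ hom₁)
    (h₂ : FormsCategory (fun T : OrderedPartialAlgebra.{u} => T.carrier) ob₂ hom₂)
    (Φ : IsoCat (FunctionCat h₁) (FunctionCat h₂)),
    (∀ S, (Φ.functor.obj S).obj = S.obj.toConstellation) ∧
    (∀ T, (Φ.inverse.obj T).obj = T.obj.toSemigroup) ∧
    (∀ (S S' : FunctionCat h₁) (f : S ⟶ S'), HEq (Φ.functor.map f).1 f.1) ∧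
    (∀ (T T' : FunctionCat h₂) (g : T ⟶ T'), HEq (Φ.inverse.map g).1 g.1)

end ESN

namespace ESN

/-! ### Isomorphisms of categories of structured sets -/

/-! In a left restriction semigroup `st = (st⁺)t`, and `(st⁺)t` is a product of `C(S)`, while `st⁺`
is the largest element below `s` fixed by right multiplication by `t⁺`, that is, the corestriction
`s|t⁺`. So the pseudo-product of `C(S)` is the original product (`pseudo_eq`). Conversely, in an
inductive constellation `s ≤ t` means `s = s⁺ ⊗ t`, and `st` is defined exactly when `s ⊗ t⁺ = s`,
so `G(T)` determines `T`.

The main work is that `⊗` is associative (`pseudo_assoc`). It rests on the formula for `((xy)|e)⁺`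
and on uniqueness of restrictions: elements below a common `x` with equal `⁺` coincide
(`eq_of_le_of_plus_eq`). In the non-degenerate locally inductive case all corestrictions exist,
because existence at one projection passes to any other through their meet.

As `C` and `G` fix underlying functions, only morphisms between constellations `C(S)` need
comparison. There the factorization `st = (st⁺)t` recovers the multiplicative law from the radiant
or preradiant axioms, which see only constellation products, corestrictions and restrictions. -/

theorem FunctionCat.hom_heq {D : Type (u + 1)} {carrier : D → Type u} {ob : D → Prop}
    {hom : ∀ A B : D, (carrier A → carrier B) → Prop} {h : FormsCategory carrier ob hom}
    {A B A' B' : FunctionCat h} (hA : A = A') (hB : B = B') {f : A ⟶ B} {g : A' ⟶ B'}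
    (hfg : HEq f.1 g.1) : HEq f g := by
  subst hA hB
  exact heq_of_eq (Subtype.ext (eq_of_heq hfg))

theorem FunctionCat.ext {D : Type (u + 1)} {carrier : D → Type u} {ob : D → Prop}
    {hom : ∀ A B : D, (carrier A → carrier B) → Prop} {h : FormsCategory carrier ob hom}
    {A B : FunctionCat h} (hAB : A.obj = B.obj) : A = B := by
  cases A; cases B; cases hAB; rfl

theorem hom_congr {D : Type (u + 1)} {carrier : D → Type u}
    {hom : ∀ A B : D, (carrier A → carrier B) → Prop} {A B A' B' : D} (hA : A = A') (hB : B = B')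
    {f : carrier A → carrier B} {g : carrier A' → carrier B'} (hfg : HEq f g) :
    hom A B f ↔ hom A' B' g := by
  subst hA hB
  rw [eq_of_heq hfg]

/-- Agreement of the two classes between objects suffices; this carries the category structure over
to (2,1)-morphisms and strong premorphisms. -/
theorem FormsCategory.congr {D : Type (u + 1)} {carrier : D → Type u} {ob : D → Prop}
    {hom hom' : ∀ A B : D, (carrier A → carrier B) → Prop} (h : FormsCategory carrier ob hom)
    (hh : ∀ A B, ob A → ob B → ∀ f, hom A B f ↔ hom' A B f) : FormsCategory carrier ob hom' where
  id A hA := (hh A A hA hA _).1 (h.id A hA)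
  comp A B C hA hB hC f g hf hg := (hh A C hA hC _).1
    (h.comp A B C hA hB hC f g ((hh A B hA hB f).2 hf) ((hh B C hB hC g).2 hg))

/-- If `C` and `G` are mutually inverse on objects and identify morphisms on one side with
morphisms on the other, then they are mutually inverse isomorphisms of categories. -/
theorem isomorphicViaCG_of {ob₁ : PartialAlgebra.{u} → Prop}
    {hom₁ : ∀ S S' : PartialAlgebra.{u}, (S.carrier → S'.carrier) → Prop}
    {ob₂ : OrderedPartialAlgebra.{u} → Prop}
    {hom₂ : ∀ T T' : OrderedPartialAlgebra.{u}, (T.carrier → T'.carrier) → Prop}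
    (hC : ∀ S, ob₁ S → ob₂ S.toConstellation) (hG : ∀ T, ob₂ T → ob₁ T.toSemigroup)
    (hGC : ∀ S, ob₁ S → S.toConstellation.toSemigroup = S)
    (hCG : ∀ T, ob₂ T → T.toSemigroup.toConstellation = T)
    (hom_iff : ∀ S S', ob₁ S → ob₁ S' → ∀ f : S.carrier → S'.carrier,
      hom₁ S S' f ↔ hom₂ S.toConstellation S'.toConstellation f)
    (h₁ : FormsCategory (fun S : PartialAlgebra.{u} => S.carrier) ob₁ hom₁) :
    IsomorphicViaCG ob₁ hom₁ ob₂ hom₂ := by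
  -- Every `T` is `C(G(T))` with the same carrier, so the comparison of morphisms over `C` also
  -- applies to `T` itself.
  have hom_iff' : ∀ T T', ob₂ T → ob₂ T' → ∀ f : T.carrier → T'.carrier,
      hom₁ T.toSemigroup T'.toSemigroup f ↔ hom₂ T T' f := fun T T' hT hT' f =>
    (hom_iff _ _ (hG T hT) (hG T' hT') f).trans
      (hom_congr (carrier := fun T : OrderedPartialAlgebra.{u} => T.carrier) (hom := hom₂)
        (hCG T hT) (hCG T' hT') (f := f) HEq.rfl)
  have h₂ : FormsCategory (fun T : OrderedPartialAlgebra.{u} => T.carrier) ob₂ hom₂ :=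
    { id := fun T hT => (hom_iff' T T hT hT _).1 (h₁.id _ (hG T hT))
      comp := fun A B C hA hB hC' f g hf hg => (hom_iff' A C hA hC' _).1
        (h₁.comp A.toSemigroup B.toSemigroup C.toSemigroup (hG A hA) (hG B hB) (hG C hC') f g
          ((hom_iff' A B hA hB f).2 hf) ((hom_iff' B C hB hC' g).2 hg)) }
  let F : FunctionCat h₁ ⥤ FunctionCat h₂ :=
    { obj := fun S => ⟨S.obj.toConstellation, hC S.obj S.property⟩
      map := fun {S S'} f => ⟨f.1, (hom_iff S.obj S'.obj S.property S'.property f.1).1 f.2⟩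
      map_id := fun _ => rfl
      map_comp := fun _ _ => rfl }
  let F' : FunctionCat h₂ ⥤ FunctionCat h₁ :=
    { obj := fun T => ⟨T.obj.toSemigroup, hG T.obj T.property⟩
      map := fun {T T'} f => ⟨f.1, (hom_iff' T.obj T'.obj T.property T'.property f.1).2 f.2⟩
      map_id := fun _ => rfl
      map_comp := fun _ _ => rfl }
  have hFF' : ∀ S, (F ⋙ F').obj S = S := fun S => FunctionCat.ext (hGC S.obj S.property)
  have hF'F : ∀ T, (F' ⋙ F).obj T = T := fun T => FunctionCat.ext (hCG T.obj T.property)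
  refine ⟨h₁, h₂, ⟨F, F', ?_, ?_⟩, fun _ => rfl, fun _ => rfl, fun _ _ _ => HEq.rfl,
    fun _ _ _ => HEq.rfl⟩
  · exact (CategoryTheory.Functor.hext hFF' fun S S' f =>
      FunctionCat.hom_heq (hFF' S) (hFF' S') HEq.rfl).symm
  · exact CategoryTheory.Functor.hext hF'F fun T T' f =>
      FunctionCat.hom_heq (hF'F T) (hF'F T') HEq.rfl

/-! ### Left restriction semigroups with a total product -/

/-- Left restriction semigroups as semigroups with a unary operation `proj s = s⁺`. -/
class LeftRestrictionSemigroup (α : Type u) extends Semigroup α where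
  proj : α → α
  proj_mul_self (s : α) : proj s * s = s
  proj_comm (s t : α) : proj s * proj t = proj t * proj s
  proj_proj_mul (s t : α) : proj (proj s * t) = proj s * proj t
  mul_proj (s t : α) : s * proj t = proj (s * t) * s

namespace LeftRestrictionSemigroup

section Basic

variable {α : Type u} [LeftRestrictionSemigroup α]

theorem proj_mul_proj_self (s : α) : proj s * proj s = proj s := by
  rw [← proj_proj_mul, proj_mul_self]

-- Since `e = s⁺` is idempotent, `e⁺ = (ee)⁺ = ee⁺ = e⁺e = e`.
@[simp] theorem proj_proj (s : α) : proj (proj s) = proj s := by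
  have h₁ : proj (proj s) = proj s * proj (proj s) := by
    conv_lhs => rw [← proj_mul_proj_self s, proj_proj_mul]
  rw [h₁, proj_comm, proj_mul_self]

theorem proj_mul_proj_mul (s t : α) : proj s * proj (s * t) = proj (s * t) := by
  rw [← proj_proj_mul, ← mul_assoc, proj_mul_self]

-- Here `st⁺ = (st)⁺s` has projection `(st)⁺s⁺`, and `s⁺` is absorbed because `s⁺(st) = st`.
@[simp] theorem proj_mul_proj (s t : α) : proj (s * proj t) = proj (s * t) := by
  rw [mul_proj, proj_proj_mul, proj_comm, proj_mul_proj_mul]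

theorem proj_eq_of_mul_proj_eq {s t : α} (h : s * proj t = s) : proj (s * t) = proj s := by
  rw [← proj_mul_proj, h]

end Basic

/-- The partial algebra underlying a left restriction semigroup. -/
abbrev toPartialAlgebra (α : Type u) [LeftRestrictionSemigroup α] : PartialAlgebra.{u} where
  carrier := α
  mul s t := Part.some (s * t)
  plus := proj

end LeftRestrictionSemigroup

/-- Totality turns the `Part`-valued product into a function. Being an equality of structures, this
allows substitution, so later claims become equational. -/
theorem PartialAlgebra.IsLeftRestrictionSemigroup.exists_eq_toPartialAlgebra
    {S : PartialAlgebra.{u}} (h : S.IsLeftRestrictionSemigroup) :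
    ∃ (α : Type u) (_ : LeftRestrictionSemigroup α),
      S = LeftRestrictionSemigroup.toPartialAlgebra α := by
  obtain ⟨α, mul, plus⟩ := S
  have hdom : ∀ s t : α, ∃ p, p ∈ mul s t := fun s t => Part.dom_iff_mem.1 (h.total s t)
  choose m hm using hdom
  obtain rfl : mul = fun s t => Part.some (m s t) := by
    funext s t; exact Part.eq_some_iff.2 (hm s t)
  refine ⟨α,
    { mul := m
      mul_assoc := fun s t r => ?_
      proj := plus
      proj_mul_self := fun s => (Part.mem_some_iff.1 (h.plus_mul s)).symm
      proj_comm := fun s t => Part.some_injective (h.plus_comm s t)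
      proj_proj_mul := fun s t => Part.mem_some_iff.1 (h.plus_plus_mul s t _ (Part.mem_some _))
      mul_proj := fun s t => ?_ }, rfl⟩
  · obtain ⟨p, hp, q, hq, w, hw, hw'⟩ := h.semigroupoid s t r (Or.inl ⟨trivial, trivial⟩)
    simp only [Part.mem_some_iff] at hp hq hw hw'
    subst hp hq
    exact hw.symm.trans hw'
  · obtain ⟨w, hw, hw'⟩ := h.mul_plus s t _ (Part.mem_some _)
    exact (Part.mem_some_iff.1 hw).symm.trans (Part.mem_some_iff.1 hw')

/-! ### Ordered left constellations -/

namespace OrderedPartialAlgebra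

variable {T : OrderedPartialAlgebra.{u}}

theorem isProj_plus (x : T.carrier) : T.IsProj (T.plus x) := ⟨x, rfl⟩

/-- The value of `corestr` is a chosen maximum; antisymmetry makes it the only one. -/
theorem mem_corestr_iff (antisymm : ∀ x y, T.le x y → T.le y x → x = y) {x e c : T.carrier} :
    c ∈ T.corestr x e ↔ T.IsCorestriction x e c := by
  constructor
  · rintro ⟨h, rfl⟩
    exact h.choose_spec
  · intro h
    refine ⟨⟨c, h⟩, ?_⟩
    have h' : T.IsCorestriction x e (Exists.choose ⟨c, h⟩) := Exists.choose_spec ⟨c, h⟩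
    exact antisymm _ _ (h.2 _ h'.1.1 h'.1.2) (h'.2 _ h.1.1 h.1.2)

theorem mem_pseudo_iff {x y w : T.carrier} :
    w ∈ T.pseudo x y ↔ ∃ c ∈ T.corestr x (T.plus y), w ∈ T.mul c y := Part.mem_bind_iff

namespace IsPreOrderedConstellation

theorem plus_mul_self (h : T.IsPreOrderedConstellation) (x : T.carrier) :
    x ∈ T.mul (T.plus x) x :=
  (h.constellation.proj_mul _ x (isProj_plus x)).2 rfl

/-- Apply the domain axiom to `x, y⁺, y`, where `y⁺y = y`. -/
theorem dom_mul_plus (h : T.IsPreOrderedConstellation) {x y : T.carrier} :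
    (T.mul x (T.plus y)).Dom ↔ (T.mul x y).Dom := by
  have hy := h.plus_mul_self y
  have key := h.constellation.dom_iff x (T.plus y) y
  constructor
  · intro hx
    obtain ⟨q, hq, hxq⟩ := key.1 ⟨hx, Part.dom_iff_mem.2 ⟨_, hy⟩⟩
    rwa [Part.mem_unique hq hy] at hxq
  · intro hx
    exact (key.2 ⟨y, hy, hx⟩).1

theorem proj_mul_proj_self (h : T.IsPreOrderedConstellation) {e : T.carrier} (he : T.IsProj e) :
    e ∈ T.mul e e := by
  obtain ⟨x, rfl⟩ := he
  exact h.constellation.mul_proj _ _ (isProj_plus x)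
    (h.dom_mul_plus.2 (Part.dom_iff_mem.2 ⟨_, h.plus_mul_self x⟩))

theorem plus_proj (h : T.IsPreOrderedConstellation) {e : T.carrier} (he : T.IsProj e) :
    T.plus e = e :=
  ((h.constellation.proj_mul e e he).1 (h.proj_mul_proj_self he)).symm

theorem plus_plus (h : T.IsPreOrderedConstellation) (x : T.carrier) :
    T.plus (T.plus x) = T.plus x := h.plus_proj (isProj_plus x)

theorem eq_of_mem_mul_proj (h : T.IsPreOrderedConstellation) {x e p : T.carrier}
    (he : T.IsProj e) (hp : p ∈ T.mul x e) : p = x :=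
  Part.mem_unique hp (h.constellation.mul_proj x e he (Part.dom_iff_mem.2 ⟨_, hp⟩))

/-- Associativity gives `x⁺(xy) = (x⁺x)y = xy`, and only `(xy)⁺` is a projection fixing `xy` on the
left. -/
theorem plus_mul (h : T.IsPreOrderedConstellation) {x y p : T.carrier} (hp : p ∈ T.mul x y) :
    T.plus p = T.plus x := by
  obtain ⟨w, hw, hw'⟩ := h.constellation.assoc _ _ _ _ (h.plus_mul_self x) _ hp
  obtain rfl := Part.mem_unique hw' hp
  exact ((h.constellation.proj_mul _ _ (isProj_plus x)).1 hw).symm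

/-- Both are restrictions of `x` to the same projection. This is the tool for identifying elements
throughout. -/
theorem eq_of_le_of_plus_eq (h : T.IsPreOrderedConstellation) {x a b : T.carrier}
    (ha : T.le a x) (hb : T.le b x) (hab : T.plus a = T.plus b) : a = b :=
  (h.restriction (T.plus b) x (isProj_plus b) (h.plus_le_plus _ _ hb)).unique ⟨ha, hab⟩ ⟨hb, rfl⟩

theorem mem_corestr_iff (h : T.IsPreOrderedConstellation) {x e c : T.carrier} :
    c ∈ T.corestr x e ↔ T.IsCorestriction x e c :=
  OrderedPartialAlgebra.mem_corestr_iff h.le_antisymm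

theorem dom_of_mem_corestr (h : T.IsPreOrderedConstellation) {x y c : T.carrier}
    (hc : c ∈ T.corestr x (T.plus y)) : (T.mul c y).Dom :=
  h.dom_mul_plus.1 (h.mem_corestr_iff.1 hc).1.2

theorem self_mem_corestr (h : T.IsPreOrderedConstellation) {x e : T.carrier}
    (hx : (T.mul x e).Dom) : x ∈ T.corestr x e :=
  h.mem_corestr_iff.2 ⟨⟨h.le_refl x, hx⟩, fun _ hy _ => hy⟩

/-- If `xy` is defined, then `x ⊗ y = xy`. -/
theorem mem_pseudo_of_mem_mul (h : T.IsPreOrderedConstellation) {x y p : T.carrier}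
    (hp : p ∈ T.mul x y) : p ∈ T.pseudo x y :=
  mem_pseudo_iff.2 ⟨x, h.self_mem_corestr
    (h.dom_mul_plus.2 (Part.dom_iff_mem.2 ⟨_, hp⟩)), hp⟩

theorem mem_pseudo_proj_iff (h : T.IsPreOrderedConstellation) {x e c : T.carrier}
    (he : T.IsProj e) : c ∈ T.pseudo x e ↔ c ∈ T.corestr x e := by
  rw [mem_pseudo_iff, h.plus_proj he]
  constructor
  · rintro ⟨d, hd, hc⟩
    rwa [h.eq_of_mem_mul_proj he hc]
  · intro hc
    exact ⟨c, hc, h.constellation.mul_proj c e he (h.mem_corestr_iff.1 hc).1.2⟩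

end IsPreOrderedConstellation

theorem isMeet_unique (h : T.IsPreOrderedConstellation) {e f m m' : T.Proj}
    (hm : IsMeet T.projLE e f m) (hm' : IsMeet T.projLE e f m') : m = m' :=
  Subtype.ext (h.le_antisymm _ _ (hm'.2.2 m hm.1 hm.2.1) (hm.2.2 m' hm'.1 hm'.2.1))

theorem connected_of_isMeet {e f m : T.Proj} (hm : IsMeet T.projLE e f m) :
    Connected T.projLE e f :=
  .trans _ _ _ (.symm _ _ (.rel _ _ hm.1)) (.rel _ _ hm.2.1)

/-! ### Inductive left constellations and their pseudo-product -/

namespace IsInductive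

theorem isMeet_of_mem_corestr (h : T.IsInductive) {e f m : T.Proj}
    (hm : m.1 ∈ T.corestr e.1 f.1) : IsMeet T.projLE e f m := by
  obtain ⟨m', hm', hc⟩ := h.meet e f
  rwa [Subtype.ext (Part.mem_unique hm hc)]

theorem le_of_dom (h : T.IsInductive) {e f : T.carrier} (he : T.IsProj e) (hf : T.IsProj f)
    (hef : (T.mul e f).Dom) : T.le e f :=
  (h.isMeet_of_mem_corestr (e := ⟨e, he⟩) (f := ⟨f, hf⟩) (m := ⟨e, he⟩)
    (h.self_mem_corestr hef)).2.1

/-- The restriction `r` of `f` to `e` is also the corestriction `e|f`, hence a projection, so `r =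
r⁺ = e`; and `(e|f)f` is defined. -/
theorem proj_mem_mul (h : T.IsInductive) {e f : T.carrier} (he : T.IsProj e) (hf : T.IsProj f)
    (hef : T.le e f) : e ∈ T.mul e f := by
  obtain ⟨r, ⟨-, hr⟩, hr'⟩ := h.restr_eq_corestr e f he hf hef
  obtain ⟨m, hm, hc⟩ := h.meet ⟨e, he⟩ ⟨f, hf⟩
  obtain rfl := Part.mem_unique hr' hc
  rw [h.plus_proj m.2] at hr
  subst hr
  exact h.constellation.mul_proj _ _ hf (h.mem_corestr_iff.1 hc).1.2

/-- Associate `x`, `e`, `f`, using `xe = x` and `ef = e`. -/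
theorem dom_mul_of_le (h : T.IsInductive) {x e f : T.carrier} (he : T.IsProj e) (hf : T.IsProj f)
    (hef : T.le e f) (hx : (T.mul x e).Dom) : (T.mul x f).Dom := by
  have hx' := h.constellation.mul_proj x e he hx
  obtain ⟨w, -, hw⟩ := h.constellation.assoc x e f x hx' e (h.proj_mem_mul he hf hef)
  exact Part.dom_iff_mem.2 ⟨w, hw⟩

/-- If `r ≤ x`, then `r = r⁺x`. -/
theorem mem_plus_mul_of_le (h : T.IsInductive) {r x : T.carrier} (hr : T.le r x) :
    r ∈ T.mul (T.plus r) x := by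
  have hd : (T.mul (T.plus r) x).Dom := h.dom_mul_plus.1 (Part.dom_iff_mem.2
    ⟨_, h.proj_mem_mul (isProj_plus r) (isProj_plus x) (h.plus_le_plus _ _ hr)⟩)
  obtain ⟨p, hp⟩ := Part.dom_iff_mem.1 hd
  have hpx : T.le p x :=
    h.mul_le_mul _ _ _ _ (h.plus_le_plus _ _ hr) (h.le_refl x) _ hp _ (h.plus_mul_self x)
  obtain rfl := h.eq_of_le_of_plus_eq hr hpx (by rw [h.plus_mul hp, h.plus_plus])
  exact hp

theorem exists_mem_corestr (h : T.IsInductive) (x : T.carrier) {e : T.carrier}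
    (he : T.IsProj e) : ∃ c, c ∈ T.corestr x e :=
  Part.dom_iff_mem.1 (h.corestriction x e he)

theorem exists_mem_pseudo (h : T.IsInductive) (x y : T.carrier) : ∃ w, w ∈ T.pseudo x y := by
  obtain ⟨c, hc⟩ := h.exists_mem_corestr x (isProj_plus y)
  obtain ⟨w, hw⟩ := Part.dom_iff_mem.1 (h.dom_of_mem_corestr hc)
  exact ⟨w, mem_pseudo_iff.2 ⟨c, hc, hw⟩⟩

theorem isProj_of_mem_corestr (h : T.IsInductive) {e f c : T.carrier} (he : T.IsProj e)
    (hf : T.IsProj f) (hc : c ∈ T.corestr e f) : T.IsProj c := by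
  obtain ⟨m, -, hm⟩ := h.meet ⟨e, he⟩ ⟨f, hf⟩
  rw [Part.mem_unique hc hm]
  exact m.2

theorem corestr_comm (h : T.IsInductive) {e f : T.carrier} (he : T.IsProj e)
    (hf : T.IsProj f) : T.corestr e f = T.corestr f e := by
  obtain ⟨m, hm, hc⟩ := h.meet ⟨e, he⟩ ⟨f, hf⟩
  obtain ⟨m', hm', hc'⟩ := h.meet ⟨f, hf⟩ ⟨e, he⟩
  obtain rfl := isMeet_unique h.toIsPreOrderedConstellation hm ⟨hm'.2.1, hm'.1, fun z h₁ h₂ =>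
    hm'.2.2 z h₂ h₁⟩
  rw [Part.eq_some_iff.2 hc, Part.eq_some_iff.2 hc']

/-- The pseudo-product `e ⊗ x` is the restriction of `x` to `e|x⁺`. -/
theorem mem_proj_pseudo (h : T.IsInductive) {e x p : T.carrier} (he : T.IsProj e)
    (hp : p ∈ T.pseudo e x) : T.le p x ∧ T.plus p ∈ T.corestr e (T.plus x) := by
  obtain ⟨c, hc, hp⟩ := mem_pseudo_iff.1 hp
  have hcp := h.isProj_of_mem_corestr he (isProj_plus x) hc
  have hle : T.le c (T.plus x) :=
    h.le_of_dom hcp (isProj_plus x) (h.mem_corestr_iff.1 hc).1.2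
  refine ⟨h.mul_le_mul _ _ _ _ hle (h.le_refl x) _ hp _ (h.plus_mul_self x), ?_⟩
  rwa [h.plus_mul hp, h.plus_proj hcp]

/-- If `r ≤ x`, then `r = r⁺ ⊗ x`. -/
theorem mem_plus_pseudo_of_le (h : T.IsInductive) {r x : T.carrier} (hr : T.le r x) :
    r ∈ T.pseudo (T.plus r) x :=
  h.mem_pseudo_of_mem_mul (h.mem_plus_mul_of_le hr)

/-- With `d = t|r⁺` and `b = s|d⁺`, both bracketings equal `b(dr) = (bd)r`. For `s ⊗ (t ⊗ r)` this
holds because `(dr)⁺ = d⁺`. For `(s ⊗ t) ⊗ r` it must be shown that `bd` is the corestriction of `p`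
to `r⁺`. -/
theorem pseudo_assoc (h : T.IsInductive) {s t r p q : T.carrier} (hp : p ∈ T.pseudo s t)
    (hq : q ∈ T.pseudo t r) : ∃ w, w ∈ T.pseudo p r ∧ w ∈ T.pseudo s q := by
  obtain ⟨s', hs', hp⟩ := mem_pseudo_iff.1 hp
  obtain ⟨d, hd, hq⟩ := mem_pseudo_iff.1 hq
  obtain ⟨b, hb⟩ := h.exists_mem_corestr s (isProj_plus d)
  obtain ⟨v, hv⟩ := Part.dom_iff_mem.1 (h.dom_of_mem_corestr hb)
  obtain ⟨w, hw, hw'⟩ := h.constellation.assoc b d r v hv q hq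
  refine ⟨w, mem_pseudo_iff.2 ⟨v, ?_, hw'⟩,
    mem_pseudo_iff.2 ⟨b, by rwa [h.plus_mul hq], hw⟩⟩
  have hs'' := h.mem_corestr_iff.1 hs'
  have hd' := h.mem_corestr_iff.1 hd
  have hb' := h.mem_corestr_iff.1 hb
  -- As `d⁺ ≤ t⁺`, the product `bt⁺` is defined, so maximality of `s' = s|t⁺` applies to `b`.
  have hbs' : T.le b s' := hs''.2 b hb'.1.1
    (h.dom_mul_of_le (isProj_plus d) (isProj_plus t) (h.plus_le_plus _ _ hd'.1.1) hb'.1.2)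
  have hb_s' : b ∈ T.corestr s' (T.plus d) := h.mem_corestr_iff.2
    ⟨⟨hbs', hb'.1.2⟩, fun y hy hyd => hb'.2 y (h.le_trans _ _ _ hy hs''.1.1) hyd⟩
  obtain ⟨c, hc⟩ := h.exists_mem_corestr p (isProj_plus r)
  -- Since `p = s't`, this gives `(p|r⁺)⁺ = (s'|d⁺)⁺ = b⁺ = (bd)⁺`; both `bd` and `p|r⁺` lie below
  -- `p`, hence they agree.
  obtain ⟨d', hd₁, b', hb₁, hcb⟩ :=
    h.plus_corestr_mul s' t (T.plus r) (isProj_plus r) p hp c hc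
  obtain rfl := Part.mem_unique hd₁ hd
  obtain rfl := Part.mem_unique hb₁ hb_s'
  have hvp : T.le v p := h.mul_le_mul _ _ _ _ hbs' hd'.1.1 _ hv _ hp
  rwa [h.eq_of_le_of_plus_eq hvp (h.mem_corestr_iff.1 hc).1.1 (by rw [hcb, h.plus_mul hv])]

/-- If `T` is an inductive left constellation, then `G(T)` is a left restriction semigroup. -/
theorem isLeftRestrictionSemigroup_toSemigroup (h : T.IsInductive) :
    T.toSemigroup.IsLeftRestrictionSemigroup where
  semigroupoid s t r _ := by
    obtain ⟨p, hp⟩ := h.exists_mem_pseudo s t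
    obtain ⟨q, hq⟩ := h.exists_mem_pseudo t r
    exact ⟨p, hp, q, hq, h.pseudo_assoc hp hq⟩
  plus_mul s := h.mem_plus_pseudo_of_le (h.le_refl s)
  plus_comm s t := Part.ext fun c => by
    change c ∈ T.pseudo _ _ ↔ c ∈ T.pseudo _ _
    rw [h.mem_pseudo_proj_iff (isProj_plus t), h.mem_pseudo_proj_iff (isProj_plus s),
      h.corestr_comm (isProj_plus s) (isProj_plus t)]
  plus_plus_mul s t p hp :=
    (h.mem_pseudo_proj_iff (isProj_plus t)).2 (h.mem_proj_pseudo (isProj_plus s) hp).2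
  mul_plus s t p hp := by
    obtain ⟨c, hc, hp⟩ := mem_pseudo_iff.1 hp
    -- The common value is `c = s|t⁺`: from `p = ct` follows `p⁺ = c⁺`, and `c ≤ s` gives `c = c⁺ ⊗
    -- s`.
    refine ⟨c, (h.mem_pseudo_proj_iff (isProj_plus t)).2 hc, ?_⟩
    change c ∈ T.pseudo (T.plus p) s
    rw [h.plus_mul hp]
    exact h.mem_plus_pseudo_of_le (h.mem_corestr_iff.1 hc).1.1
  total s t := Part.dom_iff_mem.2 (h.exists_mem_pseudo s t)

theorem natLE_toSemigroup_iff (h : T.IsInductive) {s t : T.carrier} :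
    T.toSemigroup.natLE s t ↔ T.le s t :=
  ⟨fun hst => (h.mem_proj_pseudo (isProj_plus s) hst).1, h.mem_plus_pseudo_of_le⟩

/-- The domain condition `s ⊗ t⁺ = s` says `s|t⁺ = s`, and then `s ⊗ t = st`. -/
theorem mul_toConstellation_toSemigroup (h : T.IsInductive) (s t : T.carrier) :
    T.toSemigroup.toConstellation.mul s t = T.mul s t := by
  refine Part.ext fun p => ?_
  change p ∈ Part.assert (s ∈ T.pseudo s (T.plus t)) (fun _ => T.pseudo s t) ↔ _
  rw [Part.mem_assert_iff, h.mem_pseudo_proj_iff (isProj_plus t)]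
  constructor
  · rintro ⟨hs, hp⟩
    obtain ⟨c, hc, hp⟩ := mem_pseudo_iff.1 hp
    rwa [Part.mem_unique hs hc]
  · intro hp
    exact ⟨h.self_mem_corestr (h.dom_mul_plus.2 (Part.dom_iff_mem.2 ⟨_, hp⟩)),
      h.mem_pseudo_of_mem_mul hp⟩

theorem toConstellation_toSemigroup (h : T.IsInductive) :
    T.toSemigroup.toConstellation = T := by
  have hm : T.toSemigroup.toConstellation.mul = T.mul :=
    funext₂ h.mul_toConstellation_toSemigroup
  have hle : T.toSemigroup.natLE = T.le :=
    funext₂ fun _ _ => propext h.natLE_toSemigroup_iff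
  change (⟨⟨T.carrier, T.toSemigroup.toConstellation.mul, T.plus⟩, T.toSemigroup.natLE⟩ :
    OrderedPartialAlgebra) = ⟨⟨T.carrier, T.mul, T.plus⟩, T.le⟩
  rw [hm, hle]

end IsInductive

/-- The non-degenerate li-constellations whose projections form a meet-semilattice are exactly
the inductive left constellations. -/
theorem isNonDegenerateSemilatticeLI_iff_isInductive :
    T.IsNonDegenerateSemilatticeLI ↔ T.IsInductive := by
  constructor
  · rintro ⟨h, hnd, hsl⟩
    refine { h with corestriction := ?_, meet := ?_ }
    · intro x e he
      -- Existence of `x|e₀` descends to the meet of `e₀` and `e`, then ascends to `e`.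
      obtain ⟨e₀, he₀, hx⟩ := hnd x
      obtain ⟨m, hm⟩ := hsl ⟨e₀, he₀⟩ ⟨e, he⟩
      exact (h.corestr_dom_iff x e m.1 he m.2 hm.2.1).2
        ((h.corestr_dom_iff x e₀ m.1 he₀ m.2 hm.1).1 hx)
    · intro e f
      obtain ⟨m, hm⟩ := hsl e f
      exact ⟨m, hm, (h.corestr_eq_meet e f m.1).2 ⟨connected_of_isMeet hm, m, rfl, hm⟩⟩
  · intro h
    refine ⟨{ h with
      corestriction := fun x e he _ => h.corestriction x e he
      corestr_mul_dom := fun x y e he p _ =>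
        iff_of_true (h.corestriction p e he) (h.corestriction y e he)
      corestr_dom_iff := fun x e f he hf _ =>
        iff_of_true (h.corestriction x e he) (h.corestriction x f hf)
      local_meet := fun e f _ => ⟨_, (h.meet e f).choose_spec.1⟩
      corestr_eq_meet := ?_ }, fun x => ⟨_, isProj_plus x, h.corestriction _ _ (isProj_plus x)⟩,
      fun e f => ⟨_, (h.meet e f).choose_spec.1⟩⟩
    intro e f c
    obtain ⟨m, hm, hc⟩ := h.meet e f
    constructor
    · intro hc'
      exact ⟨connected_of_isMeet hm, m, Part.mem_unique hc hc', hm⟩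
    · rintro ⟨-, m', rfl, hm'⟩
      rwa [isMeet_unique h.toIsPreOrderedConstellation hm' hm]

end OrderedPartialAlgebra

/-! ### The constellation of a left restriction semigroup -/

namespace LeftRestrictionSemigroup

section Constellation

variable {α : Type u} [LeftRestrictionSemigroup α]

theorem proj_of_isProj {e : α} (he : (toPartialAlgebra α).IsProj e) : proj e = e := by
  obtain ⟨s, rfl⟩ := he
  exact proj_proj s

theorem mul_self_of_isProj {e : α} (he : (toPartialAlgebra α).IsProj e) : e * e = e := by
  obtain ⟨s, rfl⟩ := he
  exact proj_mul_proj_self s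

theorem mul_comm_of_isProj {e f : α} (he : (toPartialAlgebra α).IsProj e)
    (hf : (toPartialAlgebra α).IsProj f) : e * f = f * e := by
  obtain ⟨s, rfl⟩ := he
  obtain ⟨t, rfl⟩ := hf
  exact proj_comm s t

theorem isProj_mul {e f : α} (he : (toPartialAlgebra α).IsProj e)
    (hf : (toPartialAlgebra α).IsProj f) : (toPartialAlgebra α).IsProj (e * f) := by
  obtain ⟨s, rfl⟩ := he
  obtain ⟨t, rfl⟩ := hf
  exact ⟨proj s * t, proj_proj_mul s t⟩

theorem natLE_iff {s t : α} : (toPartialAlgebra α).natLE s t ↔ s = proj s * t :=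
  Part.mem_some_iff

theorem natLE_refl (s : α) : (toPartialAlgebra α).natLE s s :=
  natLE_iff.2 (proj_mul_self s).symm

theorem proj_eq_of_natLE {s t : α} (h : (toPartialAlgebra α).natLE s t) :
    proj s = proj s * proj t := by
  rw [natLE_iff] at h
  rw [← proj_proj_mul, ← h]

theorem natLE_trans {s t r : α} (hst : (toPartialAlgebra α).natLE s t)
    (htr : (toPartialAlgebra α).natLE t r) : (toPartialAlgebra α).natLE s r := by
  have h := proj_eq_of_natLE hst
  rw [natLE_iff] at *
  rw [h, mul_assoc, ← htr, ← hst]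

/-- Both `s⁺` and `t⁺` equal `s⁺t⁺`, so `s = s⁺t = t⁺t = t`. -/
theorem natLE_antisymm {s t : α} (hst : (toPartialAlgebra α).natLE s t)
    (hts : (toPartialAlgebra α).natLE t s) : s = t := by
  have h := proj_eq_of_natLE hst
  have h' := proj_eq_of_natLE hts
  rw [natLE_iff] at hst
  rw [hst, h, proj_comm, ← h', proj_mul_self]

theorem proj_natLE_proj {s t : α} (h : (toPartialAlgebra α).natLE s t) :
    (toPartialAlgebra α).natLE (proj s) (proj t) := by
  rw [natLE_iff, proj_proj]
  exact proj_eq_of_natLE h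

theorem mul_natLE_of_isProj {e : α} (he : (toPartialAlgebra α).IsProj e) (s : α) :
    (toPartialAlgebra α).natLE (e * s) s := by
  obtain ⟨t, rfl⟩ := he
  rw [natLE_iff, proj_proj_mul, mul_assoc, proj_mul_self]

/-- Multiplying by a projection above `s⁺` on the left does not change `s`. -/
theorem mul_eq_of_natLE {e s : α} (h : (toPartialAlgebra α).natLE (proj s) e)
    (he : (toPartialAlgebra α).IsProj e) : e * s = s := by
  rw [natLE_iff, proj_proj, mul_comm_of_isProj ⟨s, rfl⟩ he] at h
  conv_lhs => rw [← proj_mul_self s, ← mul_assoc, ← h, proj_mul_self]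

theorem mem_toConstellation_mul_iff {s t p : α} :
    p ∈ (toPartialAlgebra α).toConstellation.mul s t ↔ s * proj t = s ∧ p = s * t := by
  change p ∈ Part.assert (s ∈ Part.some (s * proj t)) (fun _ => Part.some (s * t)) ↔ _
  rw [Part.mem_assert_iff]
  simp only [Part.mem_some_iff, exists_prop]
  exact and_congr_left fun _ => eq_comm

theorem toConstellation_mul_dom_iff {s t : α} :
    ((toPartialAlgebra α).toConstellation.mul s t).Dom ↔ s * proj t = s := by
  constructor
  · intro h
    obtain ⟨p, hp⟩ := Part.dom_iff_mem.1 h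
    exact (mem_toConstellation_mul_iff.1 hp).1
  · intro h
    exact Part.dom_iff_mem.2 ⟨_, mem_toConstellation_mul_iff.2 ⟨h, rfl⟩⟩

theorem isLeftConstellation :
    (toPartialAlgebra α).toConstellation.IsLeftConstellation where
  dom_iff x y z := by
    constructor
    · rintro ⟨hxy, hyz⟩
      have hxy := toConstellation_mul_dom_iff.1 hxy
      have hyz := toConstellation_mul_dom_iff.1 hyz
      refine ⟨_, mem_toConstellation_mul_iff.2 ⟨hyz, rfl⟩, toConstellation_mul_dom_iff.2 ?_⟩
      rw [proj_eq_of_mul_proj_eq hyz, hxy]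
    · rintro ⟨q, hq, h⟩
      obtain ⟨hyz, rfl⟩ := mem_toConstellation_mul_iff.1 hq
      have h := toConstellation_mul_dom_iff.1 h
      rw [proj_eq_of_mul_proj_eq hyz] at h
      exact ⟨toConstellation_mul_dom_iff.2 h, toConstellation_mul_dom_iff.2 hyz⟩
  assoc x y z p hp q hq := by
    obtain ⟨hxy, rfl⟩ := mem_toConstellation_mul_iff.1 hp
    obtain ⟨hyz, rfl⟩ := mem_toConstellation_mul_iff.1 hq
    refine ⟨x * (y * z), mem_toConstellation_mul_iff.2 ⟨?_, rfl⟩,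
      mem_toConstellation_mul_iff.2 ⟨?_, (mul_assoc x y z).symm⟩⟩
    · rw [proj_eq_of_mul_proj_eq hyz, hxy]
    · rw [mul_assoc, hyz]
  proj_mul e x he := by
    rw [mem_toConstellation_mul_iff]
    constructor
    · rintro ⟨h, h'⟩
      have := proj_eq_of_mul_proj_eq h
      rw [← h', proj_of_isProj he] at this
      exact this.symm
    · rintro rfl
      exact ⟨proj_mul_proj_self x, (proj_mul_self x).symm⟩
  mul_proj x e he h := by
    rw [toConstellation_mul_dom_iff] at h
    rw [mem_toConstellation_mul_iff]
    exact ⟨h, by rw [proj_of_isProj he] at h; exact h.symm⟩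

theorem isPreOrderedConstellation :
    (toPartialAlgebra α).toConstellation.IsPreOrderedConstellation where
  constellation := isLeftConstellation
  le_refl := natLE_refl
  le_trans _ _ _ := natLE_trans
  le_antisymm _ _ := natLE_antisymm
  mul_le_mul x x' y y' hxy hxy' p hp q hq := by
    obtain ⟨hx, rfl⟩ := mem_toConstellation_mul_iff.1 hp
    obtain ⟨hy, rfl⟩ := mem_toConstellation_mul_iff.1 hq
    have hxy := natLE_iff.1 hxy
    have hxy' := natLE_iff.1 hxy'
    -- Here `(xx')⁺ = x⁺`, so `(xx')⁺yy' = x⁺yy' = xy'`; also `xx' = xx'⁺y' = xy'`.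
    refine natLE_iff.2 ?_
    rw [proj_eq_of_mul_proj_eq hx, ← mul_assoc, ← hxy]
    conv_lhs => rw [hxy', ← mul_assoc, hx]
  plus_le_plus _ _ := proj_natLE_proj
  restriction e x he hex := by
    refine ⟨e * x, ⟨mul_natLE_of_isProj he x, ?_⟩, ?_⟩
    · have hex := natLE_iff.1 hex
      obtain ⟨s, rfl⟩ := he
      rw [proj_proj] at hex
      change proj (proj s * x) = proj s
      rw [proj_proj_mul]
      exact hex.symm
    · rintro r ⟨hr, rfl⟩
      exact natLE_iff.1 hr

/-- The identity `xe = (xe)⁺x` gives `xe ≤ x`. If `y = y⁺x` and `ye = y`, then `y = y⁺(xe)`, so `y ≤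
xe`. -/
theorem isCorestriction_mul {x e : α} (he : (toPartialAlgebra α).IsProj e) :
    (toPartialAlgebra α).toConstellation.IsCorestriction x e (x * e) := by
  have he' := proj_of_isProj he
  refine ⟨⟨?_, ?_⟩, fun y hy hye => ?_⟩
  · refine natLE_iff.2 ?_
    rw [← mul_proj, he']
  · rw [toConstellation_mul_dom_iff, he', mul_assoc, mul_self_of_isProj he]
  · rw [toConstellation_mul_dom_iff, he'] at hye
    have hy := natLE_iff.1 hy
    refine natLE_iff.2 ?_
    rw [← mul_assoc, ← hy, hye]

theorem corestr_eq (x : α) {e : α} (he : (toPartialAlgebra α).IsProj e) :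
    (toPartialAlgebra α).toConstellation.corestr x e = Part.some (x * e) :=
  Part.eq_some_iff.2 (isPreOrderedConstellation.mem_corestr_iff.2 (isCorestriction_mul he))

theorem pseudo_eq (x y : α) :
    (toPartialAlgebra α).toConstellation.pseudo x y = Part.some (x * y) := by
  refine Part.eq_some_iff.2 (OrderedPartialAlgebra.mem_pseudo_iff.2 ⟨x * proj y, ?_, ?_⟩)
  · rw [corestr_eq x ⟨y, rfl⟩]
    exact Part.mem_some _
  · exact mem_toConstellation_mul_iff.2
      ⟨by rw [mul_assoc, proj_mul_proj_self], by rw [mul_assoc, proj_mul_self]⟩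

theorem isInductive : (toPartialAlgebra α).toConstellation.IsInductive where
  toIsPreOrderedConstellation := isPreOrderedConstellation
  corestriction x e he := by
    rw [corestr_eq x he]
    trivial
  plus_corestr_mul x y e he p hp c hc := by
    obtain ⟨hxy, rfl⟩ := mem_toConstellation_mul_iff.1 hp
    rw [corestr_eq _ he, Part.mem_some_iff] at hc
    subst hc
    refine ⟨y * e, by rw [corestr_eq y he]; exact Part.mem_some _, x * proj (y * e), ?_, ?_⟩
    · rw [corestr_eq x ⟨y * e, rfl⟩]
      exact Part.mem_some _
    · change proj (x * y * e) = proj (x * proj (y * e))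
      rw [proj_mul_proj, mul_assoc]
  restr_eq_corestr e f he hf hef := by
    have h := natLE_iff.1 hef
    rw [proj_of_isProj he] at h
    refine ⟨e, ⟨hef, proj_of_isProj he⟩, ?_⟩
    rw [corestr_eq e hf, ← h]
    exact Part.mem_some _
  meet e f := by
    obtain ⟨e, he⟩ := e
    obtain ⟨f, hf⟩ := f
    refine ⟨⟨e * f, isProj_mul he hf⟩, ⟨?_, mul_natLE_of_isProj he f, ?_⟩, ?_⟩
    · change (toPartialAlgebra α).natLE (e * f) e
      rw [mul_comm_of_isProj he hf]
      exact mul_natLE_of_isProj hf e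
    · rintro ⟨z, hz⟩ hze hzf
      have h₁ := natLE_iff.1 hze
      have h₂ := natLE_iff.1 hzf
      rw [proj_of_isProj hz] at h₁ h₂
      refine natLE_iff.2 ?_
      rw [proj_of_isProj hz, ← mul_assoc, ← h₁]
      exact h₂
    · rw [corestr_eq e hf]
      exact Part.mem_some _

theorem toSemigroup_toConstellation :
    (toPartialAlgebra α).toConstellation.toSemigroup = toPartialAlgebra α := by
  have hm : (toPartialAlgebra α).toConstellation.pseudo = (toPartialAlgebra α).mul :=
    funext₂ pseudo_eq
  change (⟨α, (toPartialAlgebra α).toConstellation.pseudo, proj⟩ : PartialAlgebra) =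
    ⟨α, (toPartialAlgebra α).mul, proj⟩
  rw [hm]

end Constellation

/-! ### Morphisms -/

section Morphisms

variable {α β : Type u} [LeftRestrictionSemigroup α] [LeftRestrictionSemigroup β] {f : α → β}

/-! ### Morphism axioms as equations between total products -/

theorem isRestrictionMorphism_iff :
    IsRestrictionMorphism (toPartialAlgebra α) (toPartialAlgebra β) f ↔
      (∀ s t, f (s * t) = f s * f t) ∧ ∀ s, f (proj s) = proj (f s) := by
  constructor
  · rintro ⟨h₁, h₂⟩
    exact ⟨fun s t => Part.mem_some_iff.1 (h₁ s t _ (Part.mem_some _)), h₂⟩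
  · rintro ⟨h₁, h₂⟩
    refine ⟨fun s t p hp => ?_, h₂⟩
    rw [Part.mem_some_iff] at hp ⊢
    rw [hp, h₁]

theorem isTwoOneMorphism_iff :
    IsTwoOneMorphism (toPartialAlgebra α) (toPartialAlgebra β) f ↔
      (∀ s t, f (s * t) = f s * f t) ∧ ∀ s, f (proj s) = proj (f s) := by
  constructor
  · rintro ⟨h₁, h₂⟩
    exact ⟨fun s t => Part.some_injective ((Part.map_some f (s * t)).symm.trans (h₁ s t)), h₂⟩
  · rintro ⟨h₁, h₂⟩
    exact ⟨fun s t => (Part.map_some f (s * t)).trans (congrArg Part.some (h₁ s t)), h₂⟩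

theorem isPremorphism_iff :
    IsPremorphism (toPartialAlgebra α) (toPartialAlgebra β) f ↔
      (∀ s t, f s * f t = proj (f s) * f (s * t)) ∧
        ∀ s, proj (f s) = proj (f s) * f (proj s) := by
  have hle : (∀ s, (toPartialAlgebra β).natLE (proj (f s)) (f (proj s))) ↔
      ∀ s, proj (f s) = proj (f s) * f (proj s) :=
    forall_congr' fun s => by rw [natLE_iff, proj_proj]
  constructor
  · rintro ⟨h₁, h₂⟩
    refine ⟨fun s t => ?_, hle.1 h₂⟩
    obtain ⟨w, hw, hw'⟩ := h₁ s t _ (Part.mem_some _)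
    exact (Part.mem_some_iff.1 hw).symm.trans (Part.mem_some_iff.1 hw')
  · rintro ⟨h₁, h₂⟩
    refine ⟨fun s t p hp => ⟨_, Part.mem_some _, ?_⟩, hle.2 h₂⟩
    rw [Part.mem_some_iff] at hp ⊢
    rw [hp]
    exact h₁ s t

theorem isStrongPremorphism_iff :
    IsStrongPremorphism (toPartialAlgebra α) (toPartialAlgebra β) f ↔
      IsPremorphism (toPartialAlgebra α) (toPartialAlgebra β) f := by
  have key : ∀ s t : α, ((toPartialAlgebra β).mul (f s) (f t) =
      ((toPartialAlgebra α).mul s t).bind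
        fun p => (toPartialAlgebra β).mul (proj (f s)) (f p)) ↔
      f s * f t = proj (f s) * f (s * t) := fun s t => by
    rw [Part.bind_some]
    exact Part.some_inj
  constructor
  · rintro ⟨h₁, h₂⟩
    refine ⟨fun s t p hp => ⟨_, Part.mem_some _, ?_⟩, h₂⟩
    rw [Part.mem_some_iff] at hp ⊢
    rw [hp]
    exact (key s t).1 (h₁ s t)
  · intro h
    exact ⟨fun s t => (key s t).2 ((isPremorphism_iff.1 h).1 s t), h.plus_le⟩

/-- A map with `f(s)⁺ ≤ f(s⁺)` sends projections to projections. -/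
theorem isProj_map (hle : ∀ s, proj (f s) = proj (f s) * f (proj s))
    {e : α} (he : (toPartialAlgebra α).IsProj e) : (toPartialAlgebra β).IsProj (f e) := by
  obtain ⟨s, rfl⟩ := he
  refine ⟨f (proj s), ?_⟩
  -- At `s⁺` the hypothesis reads `f(s⁺)⁺ = f(s⁺)⁺f(s⁺)`, whose right side is `f(s⁺)`.
  have h := hle (proj s)
  rw [proj_proj, proj_mul_self] at h
  exact h

theorem _root_.ESN.IsPremorphism.isProj_map
    (h : IsPremorphism (toPartialAlgebra α) (toPartialAlgebra β) f)
    {e : α} (he : (toPartialAlgebra α).IsProj e) : (toPartialAlgebra β).IsProj (f e) :=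
  LeftRestrictionSemigroup.isProj_map (isPremorphism_iff.1 h).2 he

/-- From `s = s⁺t` one gets `f(s⁺)f(t) = f(s⁺)f(s)`; multiply on the left by `f(s)⁺`, which absorbs
`f(s⁺)`. -/
theorem _root_.ESN.IsPremorphism.map_le
    (h : IsPremorphism (toPartialAlgebra α) (toPartialAlgebra β) f)
    {s t : α} (hst : (toPartialAlgebra α).natLE s t) :
    (toPartialAlgebra β).natLE (f s) (f t) := by
  obtain ⟨h₁, h₂⟩ := isPremorphism_iff.1 h
  have hp := proj_of_isProj (h.isProj_map ⟨s, rfl⟩)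
  have h₃ := h₁ (proj s) t
  rw [← natLE_iff.1 hst, hp] at h₃
  refine natLE_iff.2 ?_
  rw [h₂ s, mul_assoc, h₃, ← mul_assoc, ← h₂ s, proj_mul_self]

theorem _root_.ESN.IsPremorphism.comp {γ : Type u} [LeftRestrictionSemigroup γ] {g : β → γ}
    (hf : IsPremorphism (toPartialAlgebra α) (toPartialAlgebra β) f)
    (hg : IsPremorphism (toPartialAlgebra β) (toPartialAlgebra γ) g) :
    IsPremorphism (toPartialAlgebra α) (toPartialAlgebra γ) (g ∘ f) := by
  obtain ⟨hf₁, -⟩ := isPremorphism_iff.1 hf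
  obtain ⟨hg₁, hg₂⟩ := isPremorphism_iff.1 hg
  refine ⟨fun s t p hp => ⟨_, Part.mem_some _, ?_⟩, fun s => ?_⟩
  · rw [Part.mem_some_iff] at hp
    subst hp
    refine Part.mem_some_iff.2 ?_
    change g (f s) * g (f t) = proj (g (f s)) * g (f (s * t))
    -- Expanding gives `g(f(s))⁺ g(f(s)⁺f(st))`. The inner factor `f(s)⁺` is removed by inserting
    -- `g(f(s)⁺)`, which `g(f(s))⁺` absorbs.
    have hq := proj_of_isProj (hg.isProj_map (e := proj (f s)) ⟨f s, rfl⟩)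
    have h₃ := hg₁ (proj (f s)) (f (s * t))
    rw [hq] at h₃
    rw [hg₁, hf₁, hg₂ (f s), mul_assoc, ← h₃, ← mul_assoc]
  · exact natLE_trans (hg.plus_le (f s)) (hg.map_le (hf.plus_le s))

theorem isPremorphism_id : IsPremorphism (toPartialAlgebra α) (toPartialAlgebra α) id := by
  refine isPremorphism_iff.2 ⟨fun s t => ?_, fun s => (proj_mul_proj_self s).symm⟩
  change s * t = proj s * (s * t)
  rw [← mul_assoc, proj_mul_self]

/-- Forward, `f(st) = f(st⁺)f(t) = f(s)f(t)⁺f(t) = f(s)f(t)`, by preservation of constellation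
products and of corestrictions. -/
theorem isInductiveRadiant_iff :
    IsInductiveRadiant (toPartialAlgebra α).toConstellation
        (toPartialAlgebra β).toConstellation f ↔
      IsRestrictionMorphism (toPartialAlgebra α) (toPartialAlgebra β) f := by
  rw [isRestrictionMorphism_iff]
  constructor
  · intro h
    have hplus : ∀ s, f (proj s) = proj (f s) := fun s => (h.map_plus s).symm
    refine ⟨fun s t => ?_, hplus⟩
    have h₁ : f (s * t) = f (s * proj t) * f t :=
      (mem_toConstellation_mul_iff.1 (h.map_mul (s * proj t) t (s * t)
        (mem_toConstellation_mul_iff.2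
          ⟨by rw [mul_assoc, proj_mul_proj_self], by rw [mul_assoc, proj_mul_self]⟩))).2
    have h₂ : f (s * proj t) = f s * proj (f t) := by
      have := h.map_corestr s (proj t) ⟨t, rfl⟩ (s * proj t)
        (by rw [corestr_eq s ⟨t, rfl⟩]; exact Part.mem_some _)
      rw [hplus, corestr_eq _ ⟨f t, rfl⟩] at this
      exact Part.mem_some_iff.1 this
    rw [h₁, h₂, mul_assoc, proj_mul_self]
  · rintro ⟨hmul, hplus⟩
    refine ⟨fun s t p hp => ?_, fun s => (hplus s).symm, fun s t hst => ?_,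
      fun s e he c hc => ?_⟩
    · obtain ⟨hst, rfl⟩ := mem_toConstellation_mul_iff.1 hp
      refine mem_toConstellation_mul_iff.2 ⟨?_, hmul s t⟩
      rw [← hplus, ← hmul, hst]
    · refine natLE_iff.2 ?_
      rw [← hplus, ← hmul, ← natLE_iff.1 hst]
    · rw [corestr_eq s he, Part.mem_some_iff] at hc
      obtain ⟨t, rfl⟩ := he
      rw [corestr_eq _ ⟨f t, (hplus t).symm⟩, hc]
      exact Part.mem_some_iff.2 (hmul _ _)

theorem isInductivePreradiant_iff :
    IsInductivePreradiant (toPartialAlgebra α).toConstellation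
        (toPartialAlgebra β).toConstellation f ↔
      IsPremorphism (toPartialAlgebra α) (toPartialAlgebra β) f := by
  constructor
  · intro h
    have hle : ∀ s, proj (f s) = proj (f s) * f (proj s) := fun s => by
      have := natLE_iff.1 (h.plus_le s)
      rwa [proj_proj] at this
    have hproj : ∀ {e : α}, (toPartialAlgebra α).IsProj e → (toPartialAlgebra β).IsProj (f e) :=
      isProj_map hle
    refine isPremorphism_iff.2 ⟨fun s t => ?_, hle⟩
    have h₁ : f (s * proj t) * f t = proj (f (s * proj t)) * f (s * t) := by
      obtain ⟨w, hw, hw'⟩ := h.map_mul (s * proj t) t (s * t)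
        (mem_toConstellation_mul_iff.2
          ⟨by rw [mul_assoc, proj_mul_proj_self], by rw [mul_assoc, proj_mul_self]⟩)
      rw [pseudo_eq, Part.mem_some_iff] at hw hw'
      exact hw.symm.trans hw'
    have h₂ : f (s * proj t) = f s * f (proj t) := by
      have := h.map_corestr s (proj t) ⟨t, rfl⟩ (s * proj t)
        (by rw [corestr_eq s ⟨t, rfl⟩]; exact Part.mem_some _)
      rw [corestr_eq _ (hproj ⟨t, rfl⟩)] at this
      exact Part.mem_some_iff.1 this
    -- The element `st⁺ = (st)⁺s` is the restriction of `s` to `(st)⁺`, so the restriction axiom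
    -- computes `f(st⁺)⁺`.
    have h₃ : proj (f (s * proj t)) = f (proj (s * t)) * proj (f s) := by
      have := h.plus_map_restr s (proj (s * t)) ⟨s * t, rfl⟩
        (natLE_iff.2 (by rw [proj_proj, proj_comm, proj_mul_proj_mul])) (s * proj t)
        ⟨natLE_iff.2 (by rw [proj_mul_proj, mul_proj]), proj_mul_proj s t⟩
      rw [corestr_eq _ ⟨f s, rfl⟩] at this
      exact Part.mem_some_iff.1 this
    -- Since `f(t)⁺ ≤ f(t⁺)`, the projection `f(t⁺)` fixes `f(t)` on the left; likewise for `st`.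
    have ht := mul_eq_of_natLE (h.plus_le t) (hproj ⟨t, rfl⟩)
    have hst := mul_eq_of_natLE (h.plus_le (s * t)) (hproj ⟨s * t, rfl⟩)
    calc f s * f t = f s * f (proj t) * f t := by rw [mul_assoc, ht]
      _ = proj (f s) * f (proj (s * t)) * f (s * t) := by
        rw [← h₂, h₁, h₃, mul_comm_of_isProj (hproj ⟨s * t, rfl⟩) ⟨f s, rfl⟩]
      _ = proj (f s) * f (s * t) := by rw [mul_assoc, hst]
  · intro h
    obtain ⟨hmul, hle⟩ := isPremorphism_iff.1 h
    refine ⟨fun s t p hp => ?_, h.plus_le, fun s t => h.map_le, fun s e he c hc => ?_,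
      fun s e he hes r hr => ?_⟩
    · obtain ⟨-, rfl⟩ := mem_toConstellation_mul_iff.1 hp
      rw [pseudo_eq, pseudo_eq]
      exact ⟨_, Part.mem_some _, Part.mem_some_iff.2 (hmul s t)⟩
    · rw [corestr_eq s he, Part.mem_some_iff] at hc
      rw [corestr_eq _ (h.isProj_map he), hc]
      -- Monotonicity applied to `se ≤ s` gives `f(s)⁺f(se) = f(se)`, so `f(s)f(e) = f(s)⁺f(se)`
      -- reduces to `f(se)`.
      have hse := proj_eq_of_natLE (h.map_le (isCorestriction_mul (x := s) he).1.1)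
      rw [proj_comm] at hse
      refine Part.mem_some_iff.2 ?_
      rw [hmul]
      conv_lhs => rw [← proj_mul_self (f (s * e)), hse, mul_assoc, proj_mul_self]
    · obtain ⟨hrs, rfl⟩ := hr
      rw [corestr_eq _ ⟨f s, rfl⟩]
      refine Part.mem_some_iff.2 ?_
      -- As `r = r⁺s`, one has `f(r⁺)f(s) = f(r⁺)f(r) = f(r)`; taking `⁺` yields `f(r)⁺ =
      -- f(r⁺)f(s)⁺`.
      have h₁ := hmul (proj r) s
      have hp := proj_of_isProj (h.isProj_map ⟨r, rfl⟩)
      rw [← natLE_iff.1 hrs, hp] at h₁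
      change proj (f r) = f (proj r) * proj (f s)
      have h₂ := proj_proj_mul (f (proj r)) (f s)
      rw [hp, h₁, mul_eq_of_natLE (h.plus_le r) (h.isProj_map ⟨r, rfl⟩)] at h₂
      exact h₂

theorem formsCategory_restrictionMorphism :
    FormsCategory (fun S : PartialAlgebra.{u} => S.carrier)
      (fun S => S.IsLeftRestrictionSemigroup) (fun S S' f => IsRestrictionMorphism S S' f) where
  id _ _ := ⟨fun _ _ _ hp => hp, fun _ => rfl⟩
  comp _ _ _ _ _ _ _ g hf hg := ⟨fun s t p hp => hg.map_mul _ _ _ (hf.map_mul s t p hp),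
    fun s => (congrArg g (hf.map_plus s)).trans (hg.map_plus _)⟩

theorem formsCategory_premorphism :
    FormsCategory (fun S : PartialAlgebra.{u} => S.carrier)
      (fun S => S.IsLeftRestrictionSemigroup) (fun S S' f => IsPremorphism S S' f) where
  id S hS := by
    obtain ⟨α, _, rfl⟩ := hS.exists_eq_toPartialAlgebra
    exact isPremorphism_id
  comp A B C hA hB hC f g hf hg := by
    obtain ⟨α, _, rfl⟩ := hA.exists_eq_toPartialAlgebra
    obtain ⟨β, _, rfl⟩ := hB.exists_eq_toPartialAlgebra
    obtain ⟨γ, _, rfl⟩ := hC.exists_eq_toPartialAlgebra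
    exact hf.comp hg

end Morphisms

end LeftRestrictionSemigroup

/-! ### Ordered radiants and preradiants -/

section Ordered

variable {T L : OrderedPartialAlgebra.{u}} {f : T.carrier → L.carrier}

theorem map_corestr_iff (hT : T.IsInductive) :
    (∀ x e, T.IsProj e → ∀ c ∈ T.corestr x e, f c ∈ L.corestr (f x) (f e)) ↔
      ∀ x e, T.IsProj e → (T.corestr x e).map f = L.corestr (f x) (f e) := by
  refine forall₃_congr fun x e he => ?_
  obtain ⟨c, hc⟩ := hT.exists_mem_corestr x he
  rw [Part.eq_some_iff.2 hc, Part.map_some, eq_comm, Part.eq_some_iff]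
  exact ⟨fun h => h c (Part.mem_some c), fun h d hd => by rwa [Part.mem_some_iff.1 hd]⟩

theorem isOrderedRadiant_iff (hT : T.IsInductive) :
    IsOrderedRadiant T L f ↔ IsInductiveRadiant T L f :=
  ⟨fun h => { h with map_corestr := (map_corestr_iff hT).2 h.map_corestr },
    fun h => { h with map_corestr := (map_corestr_iff hT).1 h.map_corestr }⟩

theorem isOrderedPreradiant_iff (hT : T.IsInductive) (hL : L.IsInductive) :
    IsOrderedPreradiant T L f ↔ IsInductivePreradiant T L f := by
  constructor
  · intro h
    refine { h with
      map_mul := fun x y p hp => ?_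
      map_corestr := (map_corestr_iff hT).2 h.map_corestr
      plus_map_restr := fun x e he hex r hr =>
        Part.eq_some_iff.1 (h.plus_map_restr x e he hex r hr) }
    -- Equality of partial values alone would allow both to be undefined; totality of `⊗` in `L`
    -- supplies the value.
    obtain ⟨w, hw⟩ := hL.exists_mem_pseudo (f x) (f y)
    exact ⟨w, hw, h.map_mul x y p hp ▸ hw⟩
  · intro h
    refine { h with
      map_mul := fun x y p hp => ?_
      map_corestr := (map_corestr_iff hT).1 h.map_corestr
      plus_map_restr := fun x e he hex r hr =>
        Part.eq_some_iff.2 (h.plus_map_restr x e he hex r hr) }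
    obtain ⟨w, hw, hw'⟩ := h.map_mul x y p hp
    rw [Part.eq_some_iff.2 hw, Part.eq_some_iff.2 hw']

end Ordered

/-! ### Transfer to arbitrary left restriction semigroups -/

namespace PartialAlgebra.IsLeftRestrictionSemigroup

variable {S S' : PartialAlgebra.{u}}

theorem isInductive_toConstellation (h : S.IsLeftRestrictionSemigroup) :
    S.toConstellation.IsInductive := by
  obtain ⟨α, _, rfl⟩ := h.exists_eq_toPartialAlgebra
  exact LeftRestrictionSemigroup.isInductive

theorem toSemigroup_toConstellation (h : S.IsLeftRestrictionSemigroup) :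
    S.toConstellation.toSemigroup = S := by
  obtain ⟨α, _, rfl⟩ := h.exists_eq_toPartialAlgebra
  exact LeftRestrictionSemigroup.toSemigroup_toConstellation

theorem isRestrictionMorphism_iff_isInductiveRadiant (h : S.IsLeftRestrictionSemigroup)
    (h' : S'.IsLeftRestrictionSemigroup) (f : S.carrier → S'.carrier) :
    IsRestrictionMorphism S S' f ↔
      IsInductiveRadiant S.toConstellation S'.toConstellation f := by
  obtain ⟨α, _, rfl⟩ := h.exists_eq_toPartialAlgebra
  obtain ⟨β, _, rfl⟩ := h'.exists_eq_toPartialAlgebra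
  exact LeftRestrictionSemigroup.isInductiveRadiant_iff.symm

theorem isPremorphism_iff_isInductivePreradiant (h : S.IsLeftRestrictionSemigroup)
    (h' : S'.IsLeftRestrictionSemigroup) (f : S.carrier → S'.carrier) :
    IsPremorphism S S' f ↔ IsInductivePreradiant S.toConstellation S'.toConstellation f := by
  obtain ⟨α, _, rfl⟩ := h.exists_eq_toPartialAlgebra
  obtain ⟨β, _, rfl⟩ := h'.exists_eq_toPartialAlgebra
  exact LeftRestrictionSemigroup.isInductivePreradiant_iff.symm

theorem isRestrictionMorphism_iff_isTwoOneMorphism (h : S.IsLeftRestrictionSemigroup)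
    (h' : S'.IsLeftRestrictionSemigroup) (f : S.carrier → S'.carrier) :
    IsRestrictionMorphism S S' f ↔ IsTwoOneMorphism S S' f := by
  obtain ⟨α, _, rfl⟩ := h.exists_eq_toPartialAlgebra
  obtain ⟨β, _, rfl⟩ := h'.exists_eq_toPartialAlgebra
  exact LeftRestrictionSemigroup.isRestrictionMorphism_iff.trans
    LeftRestrictionSemigroup.isTwoOneMorphism_iff.symm

theorem isPremorphism_iff_isStrongPremorphism (h : S.IsLeftRestrictionSemigroup)
    (h' : S'.IsLeftRestrictionSemigroup) (f : S.carrier → S'.carrier) :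
    IsPremorphism S S' f ↔ IsStrongPremorphism S S' f := by
  obtain ⟨α, _, rfl⟩ := h.exists_eq_toPartialAlgebra
  obtain ⟨β, _, rfl⟩ := h'.exists_eq_toPartialAlgebra
  exact LeftRestrictionSemigroup.isStrongPremorphism_iff.symm

end PartialAlgebra.IsLeftRestrictionSemigroup

/-- An identification of morphisms of left restriction semigroups with morphisms of the
corresponding inductive left constellations gives an isomorphism of categories. -/
theorem isomorphicViaCG_of_isInductive
    {hom₁ : ∀ S S' : PartialAlgebra.{u}, (S.carrier → S'.carrier) → Prop}
    {ob₂ : OrderedPartialAlgebra.{u} → Prop} (hob : ∀ T, ob₂ T ↔ T.IsInductive)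
    {hom₂ : ∀ T T' : OrderedPartialAlgebra.{u}, (T.carrier → T'.carrier) → Prop}
    (hom_iff : ∀ S S' : PartialAlgebra.{u}, S.IsLeftRestrictionSemigroup →
      S'.IsLeftRestrictionSemigroup → ∀ f : S.carrier → S'.carrier,
      hom₁ S S' f ↔ hom₂ S.toConstellation S'.toConstellation f)
    (h₁ : FormsCategory (fun S : PartialAlgebra.{u} => S.carrier)
      (fun S => S.IsLeftRestrictionSemigroup) hom₁) :
    IsomorphicViaCG (fun S => S.IsLeftRestrictionSemigroup) hom₁ ob₂ hom₂ :=
  isomorphicViaCG_of (fun _ hS => (hob _).2 hS.isInductive_toConstellation)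
    (fun T hT => ((hob T).1 hT).isLeftRestrictionSemigroup_toSemigroup)
    (fun _ hS => hS.toSemigroup_toConstellation)
    (fun T hT => ((hob T).1 hT).toConstellation_toSemigroup) hom_iff h₁

end ESN

theorem mainTheorem7 :
    -- (i) restriction morphisms and inductive radiants
    ESN.IsomorphicViaCG.{u}
      (fun S => S.IsLeftRestrictionSemigroup)
      (fun S S' f => ESN.IsRestrictionMorphism S S' f)
      (fun T => T.IsNonDegenerateSemilatticeLI)
      (fun T T' f => ESN.IsInductiveRadiant T T' f) ∧
    -- (ii) premorphisms and inductive preradiants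
    ESN.IsomorphicViaCG.{u}
      (fun S => S.IsLeftRestrictionSemigroup)
      (fun S S' f => ESN.IsPremorphism S S' f)
      (fun T => T.IsNonDegenerateSemilatticeLI)
      (fun T T' f => ESN.IsInductivePreradiant T T' f) ∧
    -- (iii) the constellations above are exactly the inductive left constellations
    (∀ T : ESN.OrderedPartialAlgebra.{u}, T.IsNonDegenerateSemilatticeLI ↔ T.IsInductive) ∧
    -- (iv) restriction morphisms of left restriction semigroups are the (2,1)-morphisms
    (∀ S S' : ESN.PartialAlgebra.{u},
      S.IsLeftRestrictionSemigroup → S'.IsLeftRestrictionSemigroup →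
      ∀ f : S.carrier → S'.carrier,
        ESN.IsRestrictionMorphism S S' f ↔ ESN.IsTwoOneMorphism S S' f) ∧
    -- (v) the one-sided theorem of Gould and Hollings, for (2,1)-morphisms
    ESN.IsomorphicViaCG.{u}
      (fun S => S.IsLeftRestrictionSemigroup)
      (fun S S' f => ESN.IsTwoOneMorphism S S' f)
      (fun T => T.IsInductive)
      (fun T T' f => ESN.IsOrderedRadiant T T' f) ∧
    -- (vi) the one-sided theorem of Gould and Hollings, for strong premorphisms
    ESN.IsomorphicViaCG.{u}
      (fun S => S.IsLeftRestrictionSemigroup)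
      (fun S S' f => ESN.IsStrongPremorphism S S' f)
      (fun T => T.IsInductive)
      (fun T T' f => ESN.IsOrderedPreradiant T T' f) :=
  have hcat₁ := ESN.LeftRestrictionSemigroup.formsCategory_restrictionMorphism.{u}
  have hcat₂ := ESN.LeftRestrictionSemigroup.formsCategory_premorphism.{u}
  ⟨ESN.isomorphicViaCG_of_isInductive
      (fun _ => ESN.OrderedPartialAlgebra.isNonDegenerateSemilatticeLI_iff_isInductive)
      (fun _ _ h h' f => h.isRestrictionMorphism_iff_isInductiveRadiant h' f) hcat₁,
    ESN.isomorphicViaCG_of_isInductive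
      (fun _ => ESN.OrderedPartialAlgebra.isNonDegenerateSemilatticeLI_iff_isInductive)
      (fun _ _ h h' f => h.isPremorphism_iff_isInductivePreradiant h' f) hcat₂,
    fun _ => ESN.OrderedPartialAlgebra.isNonDegenerateSemilatticeLI_iff_isInductive,
    fun _ _ h h' f => h.isRestrictionMorphism_iff_isTwoOneMorphism h' f,
    ESN.isomorphicViaCG_of_isInductive (fun _ => Iff.rfl)
      (fun _ _ h h' f => (h.isRestrictionMorphism_iff_isTwoOneMorphism h' f).symm.trans
        ((h.isRestrictionMorphism_iff_isInductiveRadiant h' f).trans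
          (ESN.isOrderedRadiant_iff h.isInductive_toConstellation).symm))
      (hcat₁.congr fun _ _ h h' f => h.isRestrictionMorphism_iff_isTwoOneMorphism h' f),
    ESN.isomorphicViaCG_of_isInductive (fun _ => Iff.rfl)
      (fun _ _ h h' f => (h.isPremorphism_iff_isStrongPremorphism h' f).symm.trans
        ((h.isPremorphism_iff_isInductivePreradiant h' f).trans
          (ESN.isOrderedPreradiant_iff h.isInductive_toConstellation
            h'.isInductive_toConstellation).symm))
      (hcat₂.congr fun _ _ h h' f => h.isPremorphism_iff_isStrongPremorphism h' f)⟩
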